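/- Let $X,U$ be real Hilbert spaces. Let $A:X\supset D(A)\to X$ be a linear maximal monotone operator, let $B\in L(U,X)$, and let $(x^\star,u^\star)\in D(A)\times U$ be a controlled equilibrium of $\dot x=-Ax+Bu$, $y=B^*x$, i.e. $-Ax^\star+Bu^\star=0$. For an operator $M:X\supset D(M)\to X$ such that $-M$ generates a semigroup $(S(t))_{t\ge 0}$ on $\overline{D(M)}$, i.e. $S(0)=I$ and $S(t)x_0=\lim_{n\to\infty}(I+\tfrac tn M)^{-n}x_0$ for $t>0$ and $x_0\in\overline{D(M)}$, say that $(M,B)$ fulfills the vanishing output vanishing state (VOVS) property at $x^\star$ if for all $x_0\in\overline{D(M)}$ $$\lim_{t\to\infty}B^*(S(t)x_0-x^\star)=0\quad\text{implies}\quad \lim_{t\to\infty}S(t)x_0=x^\star .$$ Suppose that $(A,B)$ is exponentially detectable: there is $L\in L(U,X)$ such that $-A+LB^*$, with domain $D(A)$, generates a strongly continuous semigroup $(T(t))_{t\ge0}$ with $\|T(t)\|\le ce^{-\omega t}$ for all $t\ge0$, for some $c\ge1$, $\omega>0$. Then the open-loop system at the equilibrium input, $\dot x=-Ax+Bu^\star$,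 $y=B^*x$, fulfills the VOVS property at $x^\star$; that is, the operator $x\mapsto Ax-Bu^\star$ on $D(A)$ has the property that its negative generates a semigroup, and together with $B$ it fulfills the VOVS property at $x^\star$. In particular, if $Bu^\star=0$ (equivalently $Ax^\star=0$), then $(A,B)$ itself, with the semigroup generated by $-A$, fulfills the VOVS property at $x^\star$. -/

import Mathlib

open Filter Topology
open scoped InnerProductSpace

/-- A single-valued, possibly nonlinear and unbounded operator `M : X ⊇ dom M → X`. -/
structure PartialOp (X : Type*) where
  /-- the domain of the operator -/
  dom : Set X
  /-- the values of the operator -/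
  toFun : dom → X

namespace PartialOp

variable {X U : Type*}
  [NormedAddCommGroup X] [InnerProductSpace ℝ X] [CompleteSpace X]
  [NormedAddCommGroup U] [InnerProductSpace ℝ U] [CompleteSpace U]

/-- A linear operator `A : X ⊇ dom A → X`, seen as a partial operator. -/
def ofLinear (A : X →ₗ.[ℝ] X) : PartialOp X where
  dom := A.domain
  toFun := fun x => A ⟨x.1, x.2⟩

/-- `⟨M x - M z, x - z⟩ ≥ 0` on the domain. -/
def IsMonotone (M : PartialOp X) : Prop :=
  ∀ x z : M.dom, 0 ≤ ⟪M.toFun x - M.toFun z, (x : X) - (z : X)⟫_ℝ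

/-- Maximal monotonicity: `M` is monotone, and every pair `(x, f)` that is monotonically related
to all of the graph of `M` already lies in this graph. -/
def IsMaximalMonotone (M : PartialOp X) : Prop :=
  M.IsMonotone ∧
    ∀ x f : X, (∀ z : M.dom, 0 ≤ ⟪f - M.toFun z, x - (z : X)⟫_ℝ) →
      ∃ hx : x ∈ M.dom, M.toFun ⟨x, hx⟩ = f

/-- `M.ResolventPow h n x y` says that `y = (I + h M)⁻ⁿ x`: there are
`z 0 = x, z 1, …, z n = y` with `z (k+1) ∈ dom M` and `(I + h M) (z (k+1)) = z k`. -/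
def ResolventPow (M : PartialOp X) (h : ℝ) (n : ℕ) (x y : X) : Prop :=
  ∃ z : ℕ → X, z 0 = x ∧ z n = y ∧
    ∀ k < n, ∃ hz : z (k + 1) ∈ M.dom, z (k + 1) + h • M.toFun ⟨z (k + 1), hz⟩ = z k

/-- `-M` generates the semigroup `(S t)`, `t ≥ 0`, on the closure of `dom M`: `S 0 = I`, and
`S t x = lim (I + (t / n) M)⁻ⁿ x` for `t > 0`. The values of `S t x` for `t ≥ 0` and
`x ∈ closure (dom M)` are determined by this if `M` is monotone; the other values play no role. -/
def GeneratesSemigroup (M : PartialOp X) (S : ℝ → X → X) : Prop :=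
  ∀ x ∈ closure M.dom, S 0 x = x ∧
    ∀ t : ℝ, 0 < t → ∃ y : ℕ → X,
      (∀ n : ℕ, 1 ≤ n → M.ResolventPow (t / n) n x (y n)) ∧ Tendsto y atTop (𝓝 (S t x))

/-- The operator `x ↦ M x - B u`, on the domain of `M`; it governs `x' = -M x + B u` for a constant
input `u`. -/
def withInput (M : PartialOp X) (B : U →L[ℝ] X) (u : U) : PartialOp X where
  dom := M.dom
  toFun := fun x => M.toFun x - B u

/-- `(x, u)` is a controlled equilibrium of `x' = -M x + B u`: `x ∈ dom M`, `-M x + B u = 0`. -/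
def IsControlledEquilibrium (M : PartialOp X) (B : U →L[ℝ] X) (x : X) (u : U) : Prop :=
  ∃ hx : x ∈ M.dom, -M.toFun ⟨x, hx⟩ + B u = 0

/-- The vanishing output vanishing state property at `xs` of the system `x' = -M x`, `y = B* x`:
for the semigroup `S` generated by `-M` (it exists, and it is unique where it matters),
`B* (S t x₀ - xs) → 0` implies `S t x₀ → xs` for all `x₀` in the closure of `dom M`. -/
def HasVOVS (M : PartialOp X) (B : U →L[ℝ] X) (xs : X) : Prop :=
  ∃ S : ℝ → X → X, M.GeneratesSemigroup S ∧
    ∀ x₀ ∈ closure M.dom,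
      Tendsto (fun t => (ContinuousLinearMap.adjoint B) (S t x₀ - xs)) atTop (𝓝 0) →
        Tendsto (fun t => S t x₀) atTop (𝓝 xs)

end PartialOp

/-- `(T t)`, `t ≥ 0`, is a strongly continuous semigroup of bounded linear operators. -/
structure IsC0Semigroup {X : Type*} [NormedAddCommGroup X] [InnerProductSpace ℝ X]
    (T : ℝ → X →L[ℝ] X) : Prop where
  zero : T 0 = ContinuousLinearMap.id ℝ X
  add : ∀ s t : ℝ, 0 ≤ s → 0 ≤ t → T (s + t) = (T s).comp (T t)
  strongly_continuous : ∀ x : X, Tendsto (fun t => T t x) (𝓝[>] 0) (𝓝 x)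

/-- `G` is the infinitesimal generator of `(T t)`, with its exact domain: `x ∈ dom G` and `G x = y`
if and only if `(T t x - x) / t → y` as `t ↓ 0`. -/
def IsGeneratorOf {X : Type*} [NormedAddCommGroup X] [InnerProductSpace ℝ X]
    (G : X →ₗ.[ℝ] X) (T : ℝ → X →L[ℝ] X) : Prop :=
  ∀ x y : X, (∃ hx : x ∈ G.domain, G ⟨x, hx⟩ = y) ↔
    Tendsto (fun t : ℝ => t⁻¹ • (T t x - x)) (𝓝[>] 0) (𝓝 y)

/-- `(A, B)` is exponentially detectable: for some bounded `L : U → X` the operator `-A + L B*`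
(on `dom A`) generates an exponentially stable strongly continuous semigroup. -/
def IsExponentiallyDetectable {X U : Type*}
    [NormedAddCommGroup X] [InnerProductSpace ℝ X] [CompleteSpace X]
    [NormedAddCommGroup U] [InnerProductSpace ℝ U] [CompleteSpace U]
    (A : X →ₗ.[ℝ] X) (B : U →L[ℝ] X) : Prop :=
  ∃ (L : U →L[ℝ] X) (T : ℝ → X →L[ℝ] X),
    IsC0Semigroup T ∧
    IsGeneratorOf ((L.comp (ContinuousLinearMap.adjoint B)).toLinearMap +ᵥ (-A)) T ∧
    ∃ c ω : ℝ, 1 ≤ c ∧ 0 < ω ∧ ∀ t : ℝ, 0 ≤ t → ‖T t‖ ≤ c * Real.exp (-ω * t)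

/-! Shifting by `xs` turns the affine flow into the linear semigroup `S` of `-A`, so it suffices
that `B* S(t) w → 0` forces `S(t) w → 0`. With `C = L B*`, variation of constants over the last `τ`
units of time gives `S(t) w = T(τ) S(t-τ) w - ∫₀^τ T(r) C S(t-r) w dr`. Since `S` is contractive and
`T` decays exponentially, the norm is at most `c e^{-ωτ} ‖w‖ + (c/ω) sup ‖C S(s) w‖`, the supremum
taken over `[t-τ, t]`. Starting the window at a fixed late time makes both terms small.

`S` is the limit of backward Euler iterates of the resolvents `J h` given by Minty's theorem. Both
its existence and the estimate above go through the Yosida exponentials `exp(-t k⁻¹(I - J k))`. On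
the dense domain of `A²` these differ from the iterates by `t (2t/n + k) ‖A² x‖`
(`norm_resolvent_div_pow_sub_yosidaSemigroup_le`). They are differentiable in norm, so Duhamel's
formula holds for them up to a defect `k ‖A² x‖` (`norm_yosidaSemigroup_apply_le_of_output_le`),
which vanishes as `k → 0`. Contractivity then removes the restriction to the domain of `A²`. -/

namespace PartialOp

/-! ### Linear maximal monotone operators and Minty's theorem. -/

variable {X : Type*} [NormedAddCommGroup X] [InnerProductSpace ℝ X]

theorem IsMaximalMonotone.inner_nonneg {A : X →ₗ.[ℝ] X} (hA : (ofLinear A).IsMaximalMonotone)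
    {x y : X} (h : (x, y) ∈ A.graph) : 0 ≤ ⟪y, x⟫_ℝ := by
  obtain ⟨z, rfl, rfl⟩ := (LinearPMap.mem_graph_iff A).1 h
  have := hA.1 ⟨z.1, z.2⟩ ⟨0, A.domain.zero_mem⟩
  have h0 : A ⟨0, A.domain.zero_mem⟩ = 0 := A.map_zero
  simpa [ofLinear, h0] using this

theorem IsMaximalMonotone.mem_graph {A : X →ₗ.[ℝ] X} (hA : (ofLinear A).IsMaximalMonotone)
    {x f : X} (h : ∀ u v : X, (u, v) ∈ A.graph → 0 ≤ ⟪f - v, x - u⟫_ℝ) : (x, f) ∈ A.graph := by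
  obtain ⟨hx, hf⟩ := hA.2 x f fun z => h _ _ (A.mem_graph ⟨z.1, z.2⟩)
  exact hf ▸ A.mem_graph ⟨x, hx⟩

theorem IsMaximalMonotone.isClosed_graph {A : X →ₗ.[ℝ] X}
    (hA : (ofLinear A).IsMaximalMonotone) : IsClosed (A.graph : Set (X × X)) := by
  have : (A.graph : Set (X × X)) =
      ⋂ q ∈ A.graph, {p : X × X | 0 ≤ ⟪p.2 - q.2, p.1 - q.1⟫_ℝ} := by
    ext p
    simp only [SetLike.mem_coe, Set.mem_iInter, Set.mem_ofPred_eq]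
    exact ⟨fun hp q hq => hA.inner_nonneg (A.graph.sub_mem hp hq),
      fun h => hA.mem_graph fun u v huv => h (u, v) huv⟩
  rw [this]
  exact isClosed_biInter fun q _ => isClosed_le continuous_const (by fun_prop)

/-- If `y` is orthogonal to the domain, then `(0, y)` is monotonically related to the graph, so by
maximality `y = A 0 = 0`. -/
theorem IsMaximalMonotone.dense_domain [CompleteSpace X] {A : X →ₗ.[ℝ] X}
    (hA : (ofLinear A).IsMaximalMonotone) : Dense (A.domain : Set X) := by
  rw [Submodule.dense_iff_topologicalClosure_eq_top,
    Submodule.topologicalClosure_eq_top_iff, Submodule.eq_bot_iff]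
  intro y hy
  have h0 : ((0 : X), y) ∈ A.graph := hA.mem_graph fun u v huv => by
    have h1 := hy u (A.mem_domain_of_mem_graph huv)
    have h2 := hA.inner_nonneg huv
    rw [real_inner_comm] at h1
    simp [inner_sub_left, h1, h2]
  exact A.graph_fst_eq_zero_snd h0 rfl

/-- `J h = (I + h A)⁻¹` for all `h > 0`. -/
def IsResolventFamily (A : X →ₗ.[ℝ] X) (J : ℝ → X →L[ℝ] X) : Prop :=
  ∀ h : ℝ, 0 < h → ∀ x : X, (J h x, h⁻¹ • (x - J h x)) ∈ A.graph

/-- **Minty's theorem** for linear operators: `I + h A` is onto, with a bounded inverse. -/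
theorem IsMaximalMonotone.exists_isResolventFamily [CompleteSpace X] {A : X →ₗ.[ℝ] X}
    (hA : (ofLinear A).IsMaximalMonotone) : ∃ J, IsResolventFamily A J := by
  suffices H : ∀ h : ℝ, 0 < h → ∃ J : X →L[ℝ] X, ∀ x, (J x, h⁻¹ • (x - J x)) ∈ A.graph by
    choose! J hJ using H
    exact ⟨J, hJ⟩
  intro h hh
  have : CompleteSpace A.graph := hA.isClosed_graph.completeSpace_coe
  let φ : A.graph →L[ℝ] X :=
    (ContinuousLinearMap.fst ℝ X X + h • ContinuousLinearMap.snd ℝ X X).comp A.graph.subtypeL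
  have hφ : ∀ p : A.graph, φ p = p.1.1 + h • p.1.2 := fun p => rfl
  have hfst : ∀ p : A.graph, ‖p.1.1‖ ≤ ‖φ p‖ ∧ ‖h • p.1.2‖ ≤ ‖φ p‖ := by
    intro p
    have h1 : 0 ≤ ⟪h • p.1.2, p.1.1⟫_ℝ := by
      rw [real_inner_smul_left]
      exact mul_nonneg hh.le (hA.inner_nonneg p.2)
    have h2 : ‖φ p‖ ^ 2 = ‖p.1.1‖ ^ 2 + 2 * ⟪h • p.1.2, p.1.1⟫_ℝ + ‖h • p.1.2‖ ^ 2 := by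
      rw [hφ, norm_add_sq_real, real_inner_comm]
    constructor <;> refine le_of_sq_le_sq ?_ (norm_nonneg _) <;>
      nlinarith [sq_nonneg ‖p.1.1‖, sq_nonneg ‖h • p.1.2‖]
  -- In the graph norm `I + h A` is bounded and bounded below, so its range is closed; density of
  -- the range then suffices.
  have hanti : AntilipschitzWith (1 + ‖h⁻¹‖₊) φ := by
    refine ContinuousLinearMap.antilipschitz_of_bound φ fun p => ?_
    have h1 := hfst p
    have h2 : ‖p.1.2‖ ≤ ‖h⁻¹‖ * ‖φ p‖ := by
      calc ‖p.1.2‖ = ‖h⁻¹‖ * ‖h • p.1.2‖ := by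
            rw [← norm_smul, inv_smul_smul₀ hh.ne']
        _ ≤ _ := by gcongr; exact h1.2
    have h3 := norm_nonneg (φ p)
    have h4 : 0 ≤ ‖h⁻¹‖ * ‖φ p‖ := by positivity
    change max ‖p.1.1‖ ‖p.1.2‖ ≤ _
    simp only [NNReal.coe_add, NNReal.coe_one, coe_nnnorm]
    exact max_le (by linarith [h1.1]) (by linarith)
  have hrange : φ.range = ⊤ := by
    have hcl : IsClosed (φ.range : Set X) := hanti.isClosed_range φ.uniformContinuous
    have : CompleteSpace φ.range := hcl.completeSpace_coe
    rw [← Submodule.orthogonal_eq_bot_iff, Submodule.eq_bot_iff]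
    intro y hy
    have hy' : ∀ u v : X, (u, v) ∈ A.graph → ⟪u, y⟫_ℝ + h * ⟪v, y⟫_ℝ = 0 := fun u v huv => by
      have := hy (φ ⟨(u, v), huv⟩) ⟨_, rfl⟩
      simpa [hφ, inner_add_left, real_inner_smul_left] using this
    -- For `y` orthogonal to the range, `⟪h⁻¹ y - v, y - u⟫ = h⁻¹ ‖y‖² + ⟪v, u⟫ ≥ 0`. Testing
    -- orthogonality on the resulting graph point gives `2 ‖y‖² = 0`.
    have hyG : (y, h⁻¹ • y) ∈ A.graph := hA.mem_graph fun u v huv => by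
      have h1 := hy' u v huv
      have h2 := hA.inner_nonneg huv
      have h3 : ⟪v, y⟫_ℝ = -(h⁻¹ * ⟪u, y⟫_ℝ) := by field_simp; linarith
      have h4 : 0 ≤ h⁻¹ * ⟪y, y⟫_ℝ := mul_nonneg (by positivity) real_inner_self_nonneg
      rw [inner_sub_left, inner_sub_right, inner_sub_right, real_inner_smul_left,
        real_inner_smul_left, h3, real_inner_comm u y]
      linarith
    have h1 := hy' _ _ hyG
    rw [real_inner_smul_left, mul_inv_cancel_left₀ hh.ne'] at h1
    exact inner_self_eq_zero.1 (by linarith : ⟪y, y⟫_ℝ = 0)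
  let e := ContinuousLinearEquiv.ofBijective φ (LinearMap.ker_eq_bot.2 hanti.injective) hrange
  refine ⟨(ContinuousLinearMap.fst ℝ X X).comp (A.graph.subtypeL.comp
    (e.symm : X →L[ℝ] A.graph)), fun x => ?_⟩
  have hx : (e.symm x).1.1 + h • (e.symm x).1.2 = x := e.apply_symm_apply x
  convert (e.symm x).2 using 1
  refine Prod.ext rfl ?_
  change h⁻¹ • (x - (e.symm x).1.1) = _
  rw [inv_smul_eq_iff₀ hh.ne', sub_eq_iff_eq_add', hx]

/-! ### Resolvent calculus. -/

namespace IsResolventFamily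

variable {A : X →ₗ.[ℝ] X} {J : ℝ → X →L[ℝ] X} {h k : ℝ} {x y z : X}

/-- With `d = x - J h (x + h y)`, the two graph points differ by `(d, -h⁻¹ d)`, and monotonicity
forces `d = 0`. -/
theorem apply_add_smul (hJ : IsResolventFamily A J) (hA : (ofLinear A).IsMaximalMonotone)
    (hh : 0 < h) (hxy : (x, y) ∈ A.graph) : J h (x + h • y) = x := by
  have h1 := hA.inner_nonneg (A.graph.sub_mem hxy (hJ h hh (x + h • y)))
  have h2 : y - h⁻¹ • (x + h • y - J h (x + h • y)) = -(h⁻¹ • (x - J h (x + h • y))) := by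
    rw [add_sub_right_comm, smul_add, inv_smul_smul₀ hh.ne']
    abel
  simp only [h2, inner_neg_left, real_inner_smul_left] at h1
  have h3 : 0 ≤ ⟪x - J h (x + h • y), x - J h (x + h • y)⟫_ℝ := real_inner_self_nonneg
  have h4 : 0 < h⁻¹ := inv_pos.2 hh
  have h5 : ⟪x - J h (x + h • y), x - J h (x + h • y)⟫_ℝ = 0 := by nlinarith
  exact (sub_eq_zero.1 (inner_self_eq_zero.1 h5)).symm

/-- The Yosida approximation agrees with `(I + h A)⁻¹ A` on the domain of `A`. -/
theorem yosida_apply (hJ : IsResolventFamily A J) (hA : (ofLinear A).IsMaximalMonotone)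
    (hh : 0 < h) (hxy : (x, y) ∈ A.graph) : h⁻¹ • (x - J h x) = J h y := by
  have h1 := hJ.apply_add_smul hA hh hxy
  rw [map_add, map_smul] at h1
  rw [inv_smul_eq_iff₀ hh.ne', sub_eq_iff_eq_add', h1]

theorem norm_apply_le (hJ : IsResolventFamily A J) (hA : (ofLinear A).IsMaximalMonotone)
    (hh : 0 < h) (x : X) : ‖J h x‖ ≤ ‖x‖ := by
  have h1 := hA.inner_nonneg (hJ h hh x)
  rw [real_inner_smul_left, inner_sub_left, real_inner_self_eq_norm_sq] at h1
  have h2 := nonneg_of_mul_nonneg_right h1 (inv_pos.2 hh)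
  have h3 := real_inner_le_norm x (J h x)
  by_contra! h4
  nlinarith [norm_nonneg x]

theorem norm_apply_sub_le (hJ : IsResolventFamily A J) (hA : (ofLinear A).IsMaximalMonotone)
    (hh : 0 < h) (hxy : (x, y) ∈ A.graph) : ‖J h x - x‖ ≤ h * ‖y‖ := by
  have h1 := hJ.yosida_apply hA hh hxy
  rw [inv_smul_eq_iff₀ hh.ne'] at h1
  rw [norm_sub_rev, h1, norm_smul, Real.norm_of_nonneg hh.le]
  gcongr
  exact hJ.norm_apply_le hA hh y

theorem graph_apply (hJ : IsResolventFamily A J) (hA : (ofLinear A).IsMaximalMonotone)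
    (hh : 0 < h) (hxy : (x, y) ∈ A.graph) : (J h x, J h y) ∈ A.graph :=
  hJ.yosida_apply hA hh hxy ▸ hJ h hh x

theorem commute (hJ : IsResolventFamily A J) (hA : (ofLinear A).IsMaximalMonotone)
    (hh : 0 < h) (hk : 0 < k) : Commute (J h) (J k) := by
  ext x
  have h1 := hJ.apply_add_smul hA hk (hJ.graph_apply hA hh (hJ k hk x))
  rw [← map_smul, ← map_add, smul_inv_smul₀ hk.ne', add_sub_cancel] at h1
  exact h1.symm

/-- The domain of `A ^ 2` is dense. -/
theorem exists_graph_norm_sub_lt [CompleteSpace X] (hJ : IsResolventFamily A J)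
    (hA : (ofLinear A).IsMaximalMonotone) (w : X) {ε : ℝ} (hε : 0 < ε) :
    ∃ x y z, (x, y) ∈ A.graph ∧ (y, z) ∈ A.graph ∧ ‖x - w‖ < ε := by
  obtain ⟨u, hu, huw⟩ := hA.dense_domain.exists_dist_lt w (half_pos hε)
  obtain ⟨v, hv⟩ := A.mem_domain_iff.1 hu
  have hh : 0 < ε / 2 / (‖v‖ + 1) := by positivity
  set h := ε / 2 / (‖v‖ + 1)
  -- Applying `J h` to a point of the domain of `A` moves it into the domain of `A²`, at a cost of
  -- at most `h ‖v‖`.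
  refine ⟨J h u, J h v, _, hJ.graph_apply hA hh hv, hJ h hh v, ?_⟩
  have h1 : h * ‖v‖ < ε / 2 := by
    have : h * (‖v‖ + 1) = ε / 2 := div_mul_cancel₀ _ (by positivity)
    linarith
  rw [dist_comm, dist_eq_norm] at huw
  calc ‖J h u - w‖ ≤ ‖J h u - u‖ + ‖u - w‖ := norm_sub_le_norm_sub_add_norm_sub _ _ _
    _ < ε := by linarith [hJ.norm_apply_sub_le hA hh hv]

end IsResolventFamily

end PartialOp

/-! ### Powers of contractions and exponentials of dissipative operators. -/

theorem ContinuousLinearMap.norm_pow_apply_le_of_contraction {E : Type*} [NormedAddCommGroup E]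
    [NormedSpace ℝ E] {P : E →L[ℝ] E} (hP : ∀ x, ‖P x‖ ≤ ‖x‖) (n : ℕ) (x : E) :
    ‖(P ^ n) x‖ ≤ ‖x‖ := by
  induction n with
  | zero => simp
  | succ n ih =>
    rw [pow_succ']
    exact (hP _).trans ih

/-- Commuting contractions satisfy `‖P ^ n x - Q ^ n x‖ ≤ n ‖P x - Q x‖`. -/
theorem Commute.norm_pow_apply_sub_le {E : Type*} [NormedAddCommGroup E] [NormedSpace ℝ E]
    {P Q : E →L[ℝ] E} (hPQ : Commute P Q) (hP : ∀ x, ‖P x‖ ≤ ‖x‖) (hQ : ∀ x, ‖Q x‖ ≤ ‖x‖)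
    (n : ℕ) (x : E) : ‖(P ^ n) x - (Q ^ n) x‖ ≤ n * ‖P x - Q x‖ := by
  induction n with
  | zero => simp
  | succ n ih =>
    have h1 : P ((Q ^ n) x) = (Q ^ n) (P x) := congr($((hPQ.pow_right n).eq) x)
    have h2 : (P ^ (n + 1)) x - (Q ^ (n + 1)) x
        = P ((P ^ n) x - (Q ^ n) x) + (Q ^ n) (P x - Q x) := by
      rw [pow_succ', pow_succ, map_sub, map_sub, h1]
      simp
    rw [h2, Nat.cast_succ]
    linarith [norm_add_le (P ((P ^ n) x - (Q ^ n) x)) ((Q ^ n) (P x - Q x)),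
      hP ((P ^ n) x - (Q ^ n) x),
      ContinuousLinearMap.norm_pow_apply_le_of_contraction hQ n (P x - Q x)]

section Exp

variable {X : Type*} [NormedAddCommGroup X] [InnerProductSpace ℝ X] [CompleteSpace X]

theorem hasDerivAt_exp_smul_apply (a : X →L[ℝ] X) (x : X) (r : ℝ) :
    HasDerivAt (fun r : ℝ => NormedSpace.exp (r • a) x) (NormedSpace.exp (r • a) (a x)) r :=
  (hasDerivAt_exp_smul_const a r).clm_apply (hasDerivAt_const r x) |>.congr_deriv (by simp)

/-- A bounded dissipative operator generates a contraction semigroup. -/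
theorem norm_exp_smul_apply_le {a : X →L[ℝ] X} (ha : ∀ x, ⟪a x, x⟫_ℝ ≤ 0) {r : ℝ} (hr : 0 ≤ r)
    (x : X) : ‖NormedSpace.exp (r • a) x‖ ≤ ‖x‖ := by
  have hd (s : ℝ) : HasDerivAt (fun s : ℝ => ‖NormedSpace.exp (s • a) x‖ ^ 2)
      (2 * ⟪NormedSpace.exp (s • a) x, a (NormedSpace.exp (s • a) x)⟫_ℝ) s :=
    (((hasDerivAt_exp_smul_const' a s).clm_apply (hasDerivAt_const s x)).congr_deriv
      (by simp)).norm_sq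
  have hanti : Antitone fun s : ℝ => ‖NormedSpace.exp (s • a) x‖ ^ 2 :=
    antitone_of_deriv_nonpos (fun s => (hd s).differentiableAt) fun s => by
      rw [(hd s).deriv, real_inner_comm]
      linarith [ha (NormedSpace.exp (s • a) x)]
  have := hanti hr
  simp only [zero_smul, NormedSpace.exp_zero, one_apply_eq_self] at this
  exact le_of_sq_le_sq this (norm_nonneg _)

end Exp

/-! ### Yosida semigroups compared with the backward Euler scheme. -/

namespace PartialOp

variable {X : Type*} [NormedAddCommGroup X] [InnerProductSpace ℝ X]

/-- The semigroup generated by the negative of the Yosida approximation `k⁻¹ (I - J k)`. -/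
noncomputable def yosidaSemigroup (J : ℝ → X →L[ℝ] X) (k r : ℝ) : X →L[ℝ] X :=
  NormedSpace.exp (r • k⁻¹ • (J k - 1))

namespace IsResolventFamily

variable {A : X →ₗ.[ℝ] X} {J : ℝ → X →L[ℝ] X} {h k r : ℝ} {x y z : X}

theorem hasDerivAt_yosidaSemigroup [CompleteSpace X] (hJ : IsResolventFamily A J)
    (hA : (ofLinear A).IsMaximalMonotone) (hk : 0 < k) (hxy : (x, y) ∈ A.graph) (r : ℝ) :
    HasDerivAt (fun r => yosidaSemigroup J k r x) (-yosidaSemigroup J k r (J k y)) r := by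
  refine (hasDerivAt_exp_smul_apply _ x r).congr_deriv ?_
  rw [← hJ.yosida_apply hA hk hxy, ← map_neg, ← smul_neg, neg_sub]
  rfl

theorem norm_yosidaSemigroup_apply_le [CompleteSpace X] (hJ : IsResolventFamily A J)
    (hA : (ofLinear A).IsMaximalMonotone) (hk : 0 < k) (hr : 0 ≤ r) (x : X) :
    ‖yosidaSemigroup J k r x‖ ≤ ‖x‖ := by
  refine norm_exp_smul_apply_le (fun x => ?_) hr x
  simp only [smul_apply, sub_apply,
    one_apply_eq_self, real_inner_smul_left, inner_sub_left]
  refine mul_nonpos_of_nonneg_of_nonpos (inv_nonneg.2 hk.le) ?_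
  rw [real_inner_self_eq_norm_sq]
  nlinarith [real_inner_le_norm (J k x) x, hJ.norm_apply_le hA hk x, norm_nonneg x]

theorem commute_yosidaSemigroup (hJ : IsResolventFamily A J)
    (hA : (ofLinear A).IsMaximalMonotone) (hh : 0 < h) (hk : 0 < k) (r : ℝ) :
    Commute (J h) (yosidaSemigroup J k r) :=
  ((((hJ.commute hA hh hk).sub_right (Commute.one_right _)).smul_right _).smul_right _).exp_right

/-- The exponential commutes with `J k`, hence with `A`. This keeps the Yosida orbit in the domain
of the generator of `T`. -/
theorem graph_yosidaSemigroup (hJ : IsResolventFamily A J)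
    (hA : (ofLinear A).IsMaximalMonotone) (hk : 0 < k) (hxy : (x, y) ∈ A.graph) (r : ℝ) :
    (yosidaSemigroup J k r x, yosidaSemigroup J k r y) ∈ A.graph := by
  have h1 : J k (yosidaSemigroup J k r (x + k • y)) = yosidaSemigroup J k r x := by
    conv_rhs => rw [← hJ.apply_add_smul hA hk hxy]
    exact congr($((hJ.commute_yosidaSemigroup hA hk hk r).eq) (x + k • y))
  have h2 := hJ k hk (yosidaSemigroup J k r (x + k • y))
  rwa [h1, ← map_sub, add_sub_cancel_left, map_smul, inv_smul_smul₀ hk.ne'] at h2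

@[simp] theorem yosidaSemigroup_zero (J : ℝ → X →L[ℝ] X) (k : ℝ) : yosidaSemigroup J k 0 = 1 := by
  simp [yosidaSemigroup]

theorem norm_yosidaSemigroup_apply_sub_le [CompleteSpace X] (hJ : IsResolventFamily A J)
    (hA : (ofLinear A).IsMaximalMonotone) (hk : 0 < k) (hr : 0 ≤ r) (hxy : (x, y) ∈ A.graph) :
    ‖yosidaSemigroup J k r x - x‖ ≤ ‖y‖ * r := by
  have := norm_image_sub_le_of_norm_deriv_le_segment' (a := 0) (b := r) (C := ‖y‖)
    (fun s _ => (hJ.hasDerivAt_yosidaSemigroup hA hk hxy s).hasDerivWithinAt)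
    (fun s hs => by
      rw [norm_neg]
      exact (hJ.norm_yosidaSemigroup_apply_le hA hk hs.1 _).trans (hJ.norm_apply_le hA hk y))
    r (Set.right_mem_Icc.2 hr)
  simpa using this

theorem norm_yosidaSemigroup_apply_sub_add_le [CompleteSpace X] (hJ : IsResolventFamily A J)
    (hA : (ofLinear A).IsMaximalMonotone) (hk : 0 < k) (hr : 0 ≤ r) (hxy : (x, y) ∈ A.graph)
    (hyz : (y, z) ∈ A.graph) :
    ‖yosidaSemigroup J k r x - x + r • J k y‖ ≤ ‖z‖ * r * r := by
  have := norm_image_sub_le_of_norm_deriv_le_segment' (a := 0) (b := r) (C := ‖z‖ * r)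
    (fun s _ => ((hJ.hasDerivAt_yosidaSemigroup hA hk hxy s).add
      ((hasDerivAt_id s).smul_const (J k y))).hasDerivWithinAt)
    (fun s hs => by
      rw [one_smul, neg_add_eq_sub, norm_sub_rev]
      refine (hJ.norm_yosidaSemigroup_apply_sub_le hA hk hs.1 (hJ.graph_apply hA hk hyz)).trans ?_
      have := hJ.norm_apply_le hA hk z
      gcongr
      exacts [hs.1, hs.2.le])
    r (Set.right_mem_Icc.2 hr)
  simpa [add_sub_right_comm] using this

/-- Local error of one Euler step: `J h x = x - h J h y`, the exponential is `x - h J k y` up to `h²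
‖z‖`, and both `J h y` and `J k y` are close to `y`. -/
theorem norm_resolvent_sub_yosidaSemigroup_le [CompleteSpace X] (hJ : IsResolventFamily A J)
    (hA : (ofLinear A).IsMaximalMonotone) (hh : 0 < h) (hk : 0 < k) (hxy : (x, y) ∈ A.graph)
    (hyz : (y, z) ∈ A.graph) :
    ‖J h x - yosidaSemigroup J k h x‖ ≤ h * (2 * h + k) * ‖z‖ := by
  have h1 := hJ.norm_yosidaSemigroup_apply_sub_add_le hA hk hh.le hxy hyz
  have h2 := hJ.yosida_apply hA hh hxy
  rw [inv_smul_eq_iff₀ hh.ne', sub_eq_iff_eq_add'] at h2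
  have h3 := hJ.norm_apply_sub_le hA hh hyz
  have h4 := hJ.norm_apply_sub_le hA hk hyz
  have h5 : J h x - yosidaSemigroup J k h x
      = h • ((J k y - y) - (J h y - y)) - (yosidaSemigroup J k h x - x + h • J k y) := by
    rw [sub_sub_sub_cancel_right, smul_sub]
    nth_rewrite 4 [h2]
    abel
  calc _ ≤ h * (‖J k y - y‖ + ‖J h y - y‖) + ‖yosidaSemigroup J k h x - x + h • J k y‖ := by
        rw [h5]
        refine (norm_sub_le _ _).trans ?_
        rw [norm_smul, Real.norm_of_nonneg hh.le]
        gcongr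
        exact norm_sub_le _ _
    _ ≤ h * (k * ‖z‖ + h * ‖z‖) + ‖z‖ * h * h := by gcongr
    _ = _ := by ring

/-- Comparison of the backward Euler scheme with the Yosida approximation on the domain
of `A ^ 2`. -/
theorem norm_resolvent_pow_sub_yosidaSemigroup_le [CompleteSpace X] (hJ : IsResolventFamily A J)
    (hA : (ofLinear A).IsMaximalMonotone) (hh : 0 < h) (hk : 0 < k) (hxy : (x, y) ∈ A.graph)
    (hyz : (y, z) ∈ A.graph) (n : ℕ) :
    ‖(J h ^ n) x - yosidaSemigroup J k (n * h) x‖ ≤ n * h * (2 * h + k) * ‖z‖ := by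
  -- Instance needed by `NormedSpace.exp_nsmul`.
  have : NormedAlgebra ℚ (X →L[ℝ] X) := NormedAlgebra.restrictScalars ℚ ℝ _
  have h1 : yosidaSemigroup J k (n * h) = yosidaSemigroup J k h ^ n := by
    rw [yosidaSemigroup, yosidaSemigroup, ← NormedSpace.exp_nsmul, mul_smul, Nat.cast_smul_eq_nsmul]
  rw [h1]
  refine ((hJ.commute_yosidaSemigroup hA hh hk h).norm_pow_apply_sub_le (hJ.norm_apply_le hA hh)
    (hJ.norm_yosidaSemigroup_apply_le hA hk hh.le) n x).trans ?_
  calc _ ≤ n * (h * (2 * h + k) * ‖z‖) := by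
        gcongr
        exact hJ.norm_resolvent_sub_yosidaSemigroup_le hA hh hk hxy hyz
    _ = _ := by ring

end IsResolventFamily
end PartialOp

/-! ### Existence of the semigroup generated by `-A`. -/

namespace PartialOp.IsResolventFamily

variable {X : Type*} [NormedAddCommGroup X] [InnerProductSpace ℝ X]
  {A : X →ₗ.[ℝ] X} {J : ℝ → X →L[ℝ] X} {k t : ℝ} {x y z s : X}

theorem norm_resolvent_div_pow_sub_yosidaSemigroup_le [CompleteSpace X] (hJ : IsResolventFamily A J)
    (hA : (ofLinear A).IsMaximalMonotone) (ht : 0 < t) (hk : 0 < k) (hxy : (x, y) ∈ A.graph)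
    (hyz : (y, z) ∈ A.graph) {n : ℕ} (hn : n ≠ 0) :
    ‖(J (t / n) ^ n) x - yosidaSemigroup J k t x‖ ≤ t * (2 * (t / n) + k) * ‖z‖ := by
  have hn' : (0 : ℝ) < n := by positivity
  have := hJ.norm_resolvent_pow_sub_yosidaSemigroup_le hA (div_pos ht hn') hk hxy hyz n
  rwa [mul_div_cancel₀ _ hn'.ne'] at this

theorem norm_resolvent_div_pow_apply_le (hJ : IsResolventFamily A J)
    (hA : (ofLinear A).IsMaximalMonotone) (ht : 0 < t) (n : ℕ) (x : X) :
    ‖(J (t / n) ^ n) x‖ ≤ ‖x‖ := by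
  rcases Nat.eq_zero_or_pos n with rfl | hn
  · simp
  · exact ContinuousLinearMap.norm_pow_apply_le_of_contraction
      (hJ.norm_apply_le hA (by positivity)) n x

/-- Convergence of the backward Euler scheme. -/
theorem exists_tendsto_resolvent_pow [CompleteSpace X] (hJ : IsResolventFamily A J)
    (hA : (ofLinear A).IsMaximalMonotone) (ht : 0 < t) (x : X) :
    ∃ s, Tendsto (fun n : ℕ => (J (t / n) ^ n) x) atTop (𝓝 s) := by
  refine cauchySeq_tendsto_of_complete (Metric.cauchySeq_iff'.2 fun ε hε => ?_)
  obtain ⟨w, y, z, hwy, hyz, hw⟩ :=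
    hJ.exists_graph_norm_sub_lt hA x (show 0 < ε / 8 by positivity)
  have hδ : 0 < ε / (8 * t * (‖z‖ + 1)) := by positivity
  -- `δ` is the Yosida parameter and, for `n ≥ N`, also bounds `2t/n`. All late iterates are then
  -- close to the one vector `yosidaSemigroup J δ t w`, which does not depend on `n`.
  set δ := ε / (8 * t * (‖z‖ + 1)) with hδ_def
  obtain ⟨N, hN⟩ := exists_nat_gt (2 * t / δ)
  have hN0 : (0 : ℝ) < N := lt_of_le_of_lt (by positivity) hN
  have key : ∀ n : ℕ, N ≤ n → ‖(J (t / n) ^ n) x - yosidaSemigroup J δ t w‖ < ε / 2 := by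
    intro n hn
    have hNn : (N : ℝ) ≤ n := by exact_mod_cast hn
    have hn0 : (0 : ℝ) < n := hN0.trans_le hNn
    have h1 := hJ.norm_resolvent_div_pow_sub_yosidaSemigroup_le hA ht hδ hwy hyz
      (by exact_mod_cast hn0.ne' : n ≠ 0)
    have h2 : 2 * (t / n) ≤ δ := by
      rw [div_lt_iff₀ hδ] at hN
      rw [← mul_div_assoc, div_le_iff₀ hn0]
      nlinarith
    have h3 := hJ.norm_resolvent_div_pow_apply_le hA ht n (w - x)
    have h4 : t * (2 * (t / n) + δ) * ‖z‖ ≤ ε / 4 := by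
      have h5 : δ * (8 * t * (‖z‖ + 1)) = ε := div_mul_cancel₀ _ (by positivity)
      calc t * (2 * (t / n) + δ) * ‖z‖ ≤ t * (δ + δ) * (‖z‖ + 1) := by
            gcongr
            linarith
        _ = ε / 4 := by linarith
    have h6 : (J (t / n) ^ n) x - yosidaSemigroup J δ t w
        = ((J (t / n) ^ n) w - yosidaSemigroup J δ t w) - (J (t / n) ^ n) (w - x) := by
      rw [map_sub]
      abel
    rw [h6]
    linarith [norm_sub_le ((J (t / n) ^ n) w - yosidaSemigroup J δ t w)
      ((J (t / n) ^ n) (w - x))]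
  refine ⟨N, fun n hn => ?_⟩
  have h1 := key n hn
  have h2 := key N le_rfl
  rw [← dist_eq_norm] at h1 h2
  linarith [dist_triangle_right ((J (t / n) ^ n) x) ((J (t / N) ^ N) x)
    (yosidaSemigroup J δ t w)]

theorem norm_limit_sub_yosidaSemigroup_le [CompleteSpace X] (hJ : IsResolventFamily A J)
    (hA : (ofLinear A).IsMaximalMonotone) (ht : 0 < t) (hk : 0 < k) (hxy : (x, y) ∈ A.graph)
    (hyz : (y, z) ∈ A.graph) (hs : Tendsto (fun n : ℕ => (J (t / n) ^ n) x) atTop (𝓝 s)) :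
    ‖s - yosidaSemigroup J k t x‖ ≤ t * k * ‖z‖ := by
  have h1 : Tendsto (fun n : ℕ => t * (2 * (t / n) + k) * ‖z‖) atTop
      (𝓝 (t * (2 * 0 + k) * ‖z‖)) :=
    ((((tendsto_const_div_atTop_nhds_zero_nat t).const_mul 2).add_const k).const_mul t).mul_const _
  rw [mul_zero, zero_add] at h1
  refine le_of_tendsto_of_tendsto (hs.sub_const _).norm h1 ?_
  filter_upwards [eventually_ne_atTop 0] with n hn
  exact hJ.norm_resolvent_div_pow_sub_yosidaSemigroup_le hA ht hk hxy hyz hn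

end PartialOp.IsResolventFamily

/-! ### Continuity and a product rule for bounded strongly continuous semigroups. -/

namespace IsC0Semigroup

variable {X : Type*} [NormedAddCommGroup X] [InnerProductSpace ℝ X] {T : ℝ → X →L[ℝ] X}
  {M : ℝ}

/-- Factoring out `T` at the smaller of the two times reduces continuity from either side to right
continuity at `0`. -/
theorem continuousOn (hT : IsC0Semigroup T) (hM : ∀ t, 0 ≤ t → ‖T t‖ ≤ M) (x : X) :
    ContinuousOn (fun r => T r x) (Set.Ici 0) := by
  intro r hr
  have h0 : Tendsto (fun h => T h x) (𝓝[≥] 0) (𝓝 x) := by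
    have : ContinuousWithinAt (fun h => T h x) (Set.Ioi 0) 0 := by
      simpa [ContinuousWithinAt, hT.zero] using hT.strongly_continuous x
    simpa [ContinuousWithinAt, hT.zero] using continuousWithinAt_Ioi_iff_Ici.1 this
  have h1 : Tendsto (fun r' => |r' - r|) (𝓝[Set.Ici 0] r) (𝓝[≥] 0) := by
    refine tendsto_nhdsWithin_iff.2 ⟨?_, Eventually.of_forall fun r' =>
      Set.mem_Ici.2 (abs_nonneg _)⟩
    have : Continuous fun r' : ℝ => |r' - r| := by fun_prop
    simpa using (this.tendsto r).mono_left nhdsWithin_le_nhds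
  have h2 : Tendsto (fun r' => M * ‖T |r' - r| x - x‖) (𝓝[Set.Ici 0] r) (𝓝 0) := by
    simpa using (((h0.comp h1).sub_const x).norm).const_mul M
  have key : ∀ a b : ℝ, 0 ≤ a → a ≤ b → ‖T b x - T a x‖ ≤ M * ‖T (b - a) x - x‖ := by
    intro a b ha hab
    have : T b x - T a x = T a (T (b - a) x - x) := by
      rw [map_sub, ← ContinuousLinearMap.comp_apply, ← hT.add a _ ha (sub_nonneg.2 hab),
        add_sub_cancel]
    rw [this]
    exact ((T a).le_opNorm _).trans (by gcongr; exact hM a ha)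
  refine tendsto_iff_norm_sub_tendsto_zero.2
    (squeeze_zero' (Eventually.of_forall fun _ => norm_nonneg _) ?_ h2)
  filter_upwards [self_mem_nhdsWithin] with r' hr'
  rcases le_total r r' with h | h
  · rw [abs_of_nonneg (sub_nonneg.2 h)]
    exact key r r' hr h
  · rw [abs_sub_comm, abs_of_nonneg (sub_nonneg.2 h), norm_sub_rev]
    exact key r' r hr' h

theorem tendsto_apply (hM : ∀ t, 0 ≤ t → ‖T t‖ ≤ M) {l : Filter ℝ}
    {σ : ℝ → ℝ} {f : ℝ → X} {v w : X} (hσ : ∀ᶠ r in l, 0 ≤ σ r) (hf : Tendsto f l (𝓝 v))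
    (hw : Tendsto (fun r => T (σ r) v) l (𝓝 w)) : Tendsto (fun r => T (σ r) (f r)) l (𝓝 w) := by
  have h1 : Tendsto (fun r => M * ‖f r - v‖) l (𝓝 0) := by
    simpa using (hf.sub_const v).norm.const_mul M
  have h2 : Tendsto (fun r => T (σ r) (f r - v)) l (𝓝 0) := by
    refine squeeze_zero_norm' ?_ h1
    filter_upwards [hσ] with r hr
    exact ((T (σ r)).le_opNorm _).trans (by gcongr; exact hM _ hr)
  simpa using h2.add hw

theorem continuousOn_apply (hT : IsC0Semigroup T) (hM : ∀ t, 0 ≤ t → ‖T t‖ ≤ M) {f : ℝ → X}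
    {S : Set ℝ} (hS : S ⊆ Set.Ici 0) (hf : ContinuousOn f S) :
    ContinuousOn (fun r => T r (f r)) S := fun r hr =>
  tendsto_apply hM (eventually_nhdsWithin_of_forall hS) (hf r hr)
    ((hT.continuousOn hM (f r)).mono hS r hr)

/-- Factoring `T r` out of the difference quotient leaves `T (r' - r)` applied to the slope of `f`,
plus the generator quotient at `f r`. -/
theorem hasDerivWithinAt_apply (hT : IsC0Semigroup T) (hM : ∀ t, 0 ≤ t → ‖T t‖ ≤ M) {f : ℝ → X}
    {f' w : X} {r : ℝ} (hr : 0 ≤ r) (hf : HasDerivWithinAt f f' (Set.Ici r) r)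
    (hw : Tendsto (fun h : ℝ => h⁻¹ • (T h (f r) - f r)) (𝓝[>] 0) (𝓝 w)) :
    HasDerivWithinAt (fun r => T r (f r)) (T r (f' + w)) (Set.Ici r) r := by
  rw [← hasDerivWithinAt_Ioi_iff_Ici,
    hasDerivWithinAt_iff_tendsto_slope' Set.self_notMem_Ioi] at hf ⊢
  have hσ : Tendsto (fun r' => r' - r) (𝓝[>] r) (𝓝[>] 0) := by
    refine tendsto_nhdsWithin_iff.2 ⟨?_, ?_⟩
    · have : Continuous fun r' : ℝ => r' - r := by fun_prop
      simpa using (this.tendsto r).mono_left nhdsWithin_le_nhds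
    · filter_upwards [self_mem_nhdsWithin] with r' hr'
      exact Set.mem_Ioi.2 (sub_pos.2 (Set.mem_Ioi.1 hr'))
  have hσ0 : ∀ᶠ r' in 𝓝[>] r, 0 ≤ r' - r := by
    filter_upwards [self_mem_nhdsWithin] with r' hr'
    exact (sub_pos.2 (Set.mem_Ioi.1 hr')).le
  have h1 := (tendsto_apply hM hσ0 hf ((hT.strongly_continuous f').comp hσ)).add (hw.comp hσ)
  refine (((T r).continuous.tendsto _).comp h1).congr' ?_
  filter_upwards [hσ0] with r' hr'
  have h2 : T r' (f r') = T r (T (r' - r) (f r')) := by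
    rw [← ContinuousLinearMap.comp_apply, ← hT.add r _ hr hr', add_sub_cancel]
  simp only [Function.comp_apply, slope_def_module, h2, map_smul, ← smul_add, ← map_sub]
  congr 2
  rw [map_sub]
  abel

end IsC0Semigroup

/-! ### Duhamel estimate and vanishing of the state. -/

namespace PartialOp

variable {X U : Type*}
  [NormedAddCommGroup X] [InnerProductSpace ℝ X] [CompleteSpace X]
  [NormedAddCommGroup U] [InnerProductSpace ℝ U] [CompleteSpace U]

/-- Duhamel estimate: the Yosida approximation of the semigroup generated by `-A` is compared with
the exponentially stable semigroup `T` generated by `-A + C`. -/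
theorem IsResolventFamily.norm_yosidaSemigroup_apply_le_of_output_le {A : X →ₗ.[ℝ] X}
    {J : ℝ → X →L[ℝ] X} (hJ : IsResolventFamily A J) (hA : (ofLinear A).IsMaximalMonotone)
    {T : ℝ → X →L[ℝ] X} (hT : IsC0Semigroup T) {c ω : ℝ} (hω : 0 < ω)
    (hTb : ∀ t : ℝ, 0 ≤ t → ‖T t‖ ≤ c * Real.exp (-ω * t)) {C : X →L[ℝ] X}
    (hG : ∀ x y : X, (x, y) ∈ A.graph →
      Tendsto (fun t : ℝ => t⁻¹ • (T t x - x)) (𝓝[>] 0) (𝓝 (C x - y)))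
    {x y z : X} (hxy : (x, y) ∈ A.graph) (hyz : (y, z) ∈ A.graph) {k t τ ε : ℝ} (hk : 0 < k)
    (hτ : 0 ≤ τ) (hτt : τ ≤ t)
    (hε : ∀ s, t - τ ≤ s → s ≤ t → ‖C (yosidaSemigroup J k s x)‖ ≤ ε) :
    ‖yosidaSemigroup J k t x‖
      ≤ c * Real.exp (-ω * τ) * ‖x‖ + c / ω * (ε + k * ‖z‖) := by
  have hc : 0 ≤ c := by simpa using (norm_nonneg _).trans (hTb 0 le_rfl)
  have hK : 0 ≤ ε + k * ‖z‖ :=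
    add_nonneg ((norm_nonneg _).trans (hε t (by linarith) le_rfl)) (by positivity)
  have hM : ∀ t, 0 ≤ t → ‖T t‖ ≤ c := fun t ht => (hTb t ht).trans <|
    mul_le_of_le_one_right hc (Real.exp_le_one_iff.2 (by nlinarith))
  have hE : ∀ r, HasDerivAt (fun r => yosidaSemigroup J k (t - r) x)
      (yosidaSemigroup J k (t - r) (J k y)) r := fun r => by
    simpa using (hJ.hasDerivAt_yosidaSemigroup hA hk hxy (t - r)).comp_const_sub t r
  have hg : ∀ r ∈ Set.Ico 0 τ, HasDerivWithinAt
      (fun r => T r (yosidaSemigroup J k (t - r) x) - yosidaSemigroup J k t x)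
      (T r (yosidaSemigroup J k (t - r) (J k y) +
        (C (yosidaSemigroup J k (t - r) x) - yosidaSemigroup J k (t - r) y))) (Set.Ici r) r :=
    fun r hr => (hT.hasDerivWithinAt_apply hM hr.1 (hE r).hasDerivWithinAt
      (hG _ _ (hJ.graph_yosidaSemigroup hA hk hxy (t - r)))).sub_const _
  have hcont : ContinuousOn
      (fun r => T r (yosidaSemigroup J k (t - r) x) - yosidaSemigroup J k t x) (Set.Icc 0 τ) :=
    (hT.continuousOn_apply hM (fun r hr => hr.1)
      fun r _ => (hE r).continuousAt.continuousWithinAt).sub continuousOn_const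
  -- The primitive, zero at `r = 0`, of the bound for the derivative; the mean value inequality with
  -- this majorant replaces the Duhamel integral.
  have hB : ∀ r, HasDerivAt (fun r => c / ω * (ε + k * ‖z‖) * (1 - Real.exp (-ω * r)))
      (c * Real.exp (-ω * r) * (ε + k * ‖z‖)) r := fun r => by
    refine ((((hasDerivAt_id r).const_mul (-ω)).exp.const_sub 1).const_mul
      (c / ω * (ε + k * ‖z‖))).congr_deriv ?_
    simp only [id]
    field_simp
  have h1 := image_norm_le_of_norm_deriv_right_le_deriv_boundary hcont hg (by simp [hT.zero]) hB
    (fun r hr => by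
      have h2 : ‖yosidaSemigroup J k (t - r) (J k y) +
          (C (yosidaSemigroup J k (t - r) x) - yosidaSemigroup J k (t - r) y)‖ ≤ ε + k * ‖z‖ := by
        have h3 : 0 ≤ t - r := by linarith [hr.2]
        have h4 := hJ.norm_yosidaSemigroup_apply_le hA hk h3 (J k y - y)
        have h5 := hJ.norm_apply_sub_le hA hk hyz
        have h6 := hε (t - r) (by linarith [hr.2]) (by linarith [hr.1])
        -- The Yosida derivative carries `J k y` where `A` would give `y`; the mismatch is the
        -- defect `k ‖z‖`.
        rw [add_sub_left_comm, ← map_sub]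
        exact (norm_add_le _ _).trans (by linarith)
      exact ((T r).le_opNorm _).trans (by
        have := hTb r hr.1
        gcongr)) (Set.right_mem_Icc.2 hτ)
  have h2 : ‖T τ (yosidaSemigroup J k (t - τ) x)‖ ≤ c * Real.exp (-ω * τ) * ‖x‖ := by
    refine ((T τ).le_opNorm _).trans ?_
    have h3 := hJ.norm_yosidaSemigroup_apply_le hA hk (sub_nonneg.2 hτt) x
    have h4 := hTb τ hτ
    gcongr
  have h3 : c / ω * (ε + k * ‖z‖) * (1 - Real.exp (-ω * τ)) ≤ c / ω * (ε + k * ‖z‖) :=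
    mul_le_of_le_one_right (by positivity) (by linarith [Real.exp_pos (-ω * τ)])
  have h4 := norm_le_norm_add_norm_sub (T τ (yosidaSemigroup J k (t - τ) x))
    (yosidaSemigroup J k t x)
  linarith

/-- Vanishing output implies vanishing state for the semigroup generated by `-A`. -/
theorem IsResolventFamily.tendsto_zero_of_output {A : X →ₗ.[ℝ] X}
    {J : ℝ → X →L[ℝ] X} (hJ : IsResolventFamily A J) (hA : (ofLinear A).IsMaximalMonotone)
    {B : U →L[ℝ] X} (hdet : IsExponentiallyDetectable A B) {S : ℝ → X → X}
    (hS : ∀ t, 0 < t → ∀ x, Tendsto (fun n : ℕ => (J (t / n) ^ n) x) atTop (𝓝 (S t x))) {w : X}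
    (hw : Tendsto (fun t => (ContinuousLinearMap.adjoint B) (S t w)) atTop (𝓝 0)) :
    Tendsto (fun t => S t w) atTop (𝓝 0) := by
  obtain ⟨L, T, hT, hgen, c, ω, hc, hω, hTb⟩ := hdet
  set C := L.comp (ContinuousLinearMap.adjoint B)
  have hG : ∀ x y : X, (x, y) ∈ A.graph →
      Tendsto (fun t : ℝ => t⁻¹ • (T t x - x)) (𝓝[>] 0) (𝓝 (C x - y)) := fun x y hxy => by
    obtain ⟨u, rfl, rfl⟩ := (LinearPMap.mem_graph_iff A).1 hxy
    exact (hgen _ _).1 ⟨u.2, (sub_eq_add_neg _ _).symm⟩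
  have hCw : Tendsto (fun t => C (S t w)) atTop (𝓝 0) := by
    simpa [C, Function.comp_def] using (L.continuous.tendsto 0).comp hw
  have hlip : ∀ t, 0 < t → ∀ x y, ‖S t x - S t y‖ ≤ ‖x - y‖ := fun t ht x y =>
    le_of_tendsto ((hS t ht x).sub (hS t ht y)).norm <| Eventually.of_forall fun n => by
      rw [← map_sub]
      exact hJ.norm_resolvent_div_pow_apply_le hA ht n _
  have est : ∀ x y z : X, (x, y) ∈ A.graph → (y, z) ∈ A.graph → ∀ t τ ε : ℝ, 0 ≤ τ → τ < t →
      (∀ s, t - τ ≤ s → ‖C (S s x)‖ ≤ ε) →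
      ‖S t x‖ ≤ c * Real.exp (-ω * τ) * ‖x‖ + c / ω * ε := by
    intro x y z hxy hyz t τ ε hτ hτt hε
    have ht : 0 < t := hτ.trans_lt hτt
    have h1 : ∀ k, 0 < k → ‖S t x‖ ≤ t * k * ‖z‖ + (c * Real.exp (-ω * τ) * ‖x‖ +
        c / ω * ((ε + ‖C‖ * (t * k * ‖z‖)) + k * ‖z‖)) := by
      intro k hk
      have h2 := hJ.norm_limit_sub_yosidaSemigroup_le hA ht hk hxy hyz (hS t ht x)
      have h3 := hJ.norm_yosidaSemigroup_apply_le_of_output_le hA hT hω hTb hG hxy hyz hk hτ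
        hτt.le (ε := ε + ‖C‖ * (t * k * ‖z‖)) fun s hs hst => by
          have hs0 : 0 < s := by linarith
          have h4 := hJ.norm_limit_sub_yosidaSemigroup_le hA hs0 hk hxy hyz (hS s hs0 x)
          rw [norm_sub_rev] at h4
          have h5 : C (yosidaSemigroup J k s x)
              = C (S s x) + C (yosidaSemigroup J k s x - S s x) := by
            rw [map_sub]
            abel
          rw [h5]
          refine (norm_add_le _ _).trans (add_le_add (hε s hs) ((C.le_opNorm _).trans ?_))
          gcongr
          exact h4.trans (by gcongr)
      linarith [norm_le_norm_add_norm_sub (yosidaSemigroup J k t x) (S t x),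
        norm_sub_rev (yosidaSemigroup J k t x) (S t x)]
    have h2 : Tendsto (fun k : ℝ => t * k * ‖z‖ + (c * Real.exp (-ω * τ) * ‖x‖ +
        c / ω * ((ε + ‖C‖ * (t * k * ‖z‖)) + k * ‖z‖))) (𝓝[>] 0)
        (𝓝 (c * Real.exp (-ω * τ) * ‖x‖ + c / ω * ε)) := by
      have : Continuous fun k : ℝ => t * k * ‖z‖ + (c * Real.exp (-ω * τ) * ‖x‖ +
        c / ω * ((ε + ‖C‖ * (t * k * ‖z‖)) + k * ‖z‖)) := by fun_prop
      simpa using (this.tendsto 0).mono_left nhdsWithin_le_nhds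
    exact ge_of_tendsto h2 (by filter_upwards [self_mem_nhdsWithin] with k hk using h1 k hk)
  have hc0 : 0 < c := by linarith
  rw [Metric.tendsto_atTop] at hCw ⊢
  intro ε hε
  -- The decaying term and the approximation of `w` by `x` cost `η` each, the output term `η (c/ω)
  -- (1 + ‖C‖)`; the third `η` is slack.
  have hη : 0 < ε / (3 + c / ω * (1 + ‖C‖)) := by positivity
  set η := ε / (3 + c / ω * (1 + ‖C‖)) with hη_def
  have hηε : η * (3 + c / ω * (1 + ‖C‖)) = ε := div_mul_cancel₀ _ (by positivity)
  obtain ⟨x, y, z, hxy, hyz, hxw⟩ := hJ.exists_graph_norm_sub_lt hA w hη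
  obtain ⟨t₀, ht₀⟩ := hCw η hη
  set t₁ := max t₀ 1
  have hCx : ∀ s, t₁ ≤ s → ‖C (S s x)‖ ≤ η * (1 + ‖C‖) := fun s hs => by
    have h1 := ht₀ s ((le_max_left _ _).trans hs)
    rw [dist_zero_right] at h1
    have hs0 : 0 < s := zero_lt_one.trans_le ((le_max_right _ _).trans hs)
    have h2 : ‖C (S s x - S s w)‖ ≤ ‖C‖ * η := (C.le_opNorm _).trans (by
      gcongr
      exact (hlip s hs0 x w).trans hxw.le)
    have h3 : C (S s x) = C (S s w) + C (S s x - S s w) := by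
      rw [map_sub]
      abel
    rw [h3]
    linarith [norm_add_le (C (S s w)) (C (S s x - S s w))]
  have hexp : Tendsto (fun t => c * Real.exp (-ω * (t - t₁)) * ‖x‖) atTop (𝓝 0) := by
    have h1 : Tendsto (fun t => -ω * (t - t₁)) atTop atBot :=
      (tendsto_atTop_add_const_right _ _ tendsto_id).const_mul_atTop_of_neg (by linarith)
    simpa using ((Real.tendsto_exp_atBot.comp h1).const_mul c).mul_const ‖x‖
  obtain ⟨t₂, ht₂⟩ := eventually_atTop.1 (hexp.eventually_lt_const hη)
  refine ⟨max t₁ t₂, fun t ht => ?_⟩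
  have ht₁ : t₁ ≤ t := (le_max_left _ _).trans ht
  have h1 : 1 ≤ t₁ := le_max_right _ _
  -- The window starts at the fixed time `t₁`, so its length `t - t₁` tends to infinity.
  have h2 := est x y z hxy hyz t (t - t₁) (η * (1 + ‖C‖)) (by linarith) (by linarith)
    fun s hs => hCx s (by linarith)
  have h3 := ht₂ t ((le_max_right _ _).trans ht)
  have h4 := hlip t (by linarith) w x
  rw [norm_sub_rev w x] at h4
  rw [dist_zero_right]
  have h5 := norm_le_norm_add_norm_sub (S t x) (S t w)
  rw [norm_sub_rev] at h5
  have h6 : c / ω * (η * (1 + ‖C‖)) = η * (c / ω * (1 + ‖C‖)) := by ring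
  linarith

end PartialOp

/-! ### Translation to the equilibrium. -/

theorem proposition3p8 {X U : Type*}
    [NormedAddCommGroup X] [InnerProductSpace ℝ X] [CompleteSpace X]
    [NormedAddCommGroup U] [InnerProductSpace ℝ U] [CompleteSpace U]
    (A : X →ₗ.[ℝ] X) (B : U →L[ℝ] X)
    (hA : (PartialOp.ofLinear A).IsMaximalMonotone)
    (xs : X) (us : U)
    (heq : (PartialOp.ofLinear A).IsControlledEquilibrium B xs us)
    (hdet : IsExponentiallyDetectable A B) :
    ((PartialOp.ofLinear A).withInput B us).HasVOVS B xs ∧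
      (B us = 0 → (PartialOp.ofLinear A).HasVOVS B xs) := by
  have main : ((PartialOp.ofLinear A).withInput B us).HasVOVS B xs := by
    obtain ⟨J, hJ⟩ := hA.exists_isResolventFamily
    obtain ⟨hxs, hAxs⟩ := heq
    have hG : (xs, B us) ∈ A.graph := by
      rw [neg_add_eq_zero] at hAxs
      exact hAxs ▸ A.mem_graph ⟨xs, hxs⟩
    have hlim : ∀ t : ℝ, ∃ S : X → X, (t = 0 → ∀ x, S x = x) ∧
        (0 < t → ∀ x, Tendsto (fun n : ℕ => (J (t / n) ^ n) x) atTop (𝓝 (S x))) := by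
      intro t
      rcases lt_or_ge 0 t with ht | ht
      · choose S hS using hJ.exists_tendsto_resolvent_pow hA ht
        exact ⟨S, fun h => absurd h ht.ne', fun _ => hS⟩
      · exact ⟨id, fun _ _ => rfl, fun h => absurd h ht.not_gt⟩
    choose S hS0 hS using hlim
    refine ⟨fun t x => xs + S t (x - xs), fun x _ => ⟨by simp [hS0 0 rfl], fun t ht =>
      ⟨fun n => xs + (J (t / n) ^ n) (x - xs), fun n hn => ?_, (hS t ht _).const_add xs⟩⟩,
      fun x _ hx => ?_⟩
    · have hh : 0 < t / n := div_pos ht (by exact_mod_cast hn)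
      refine ⟨fun j => xs + (J (t / n) ^ j) (x - xs), by simp, rfl, fun j _ => ?_⟩
      -- Adding `(xs, B us)` to the resolvent pair turns an Euler step for `A` into one for `x ↦ A x
      -- - B us`.
      have h1 := A.graph.add_mem hG (hJ _ hh ((J (t / n) ^ j) (x - xs)))
      obtain ⟨u, hu1, hu2⟩ := (LinearPMap.mem_graph_iff A).1 h1
      have hu3 : (u : X) = xs + (J (t / n) ^ (j + 1)) (x - xs) := by
        rw [hu1, pow_succ']
        rfl
      have hu : xs + (J (t / n) ^ (j + 1)) (x - xs) ∈ A.domain := hu3 ▸ u.2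
      refine ⟨hu, ?_⟩
      have hu4 : A ⟨xs + (J (t / n) ^ (j + 1)) (x - xs), hu⟩ = A u :=
        congrArg A (Subtype.ext hu3.symm)
      change _ + (t / n) • (A ⟨xs + (J (t / n) ^ (j + 1)) (x - xs), _⟩ - B us) = _
      have hpow : (J (t / n) ^ (j + 1)) (x - xs) = J (t / n) ((J (t / n) ^ j) (x - xs)) := by
        rw [pow_succ']
        rfl
      rw [hu4, hu2]
      dsimp only [Prod.mk_add_mk]
      rw [hpow, add_sub_cancel_left, smul_inv_smul₀ hh.ne']
      abel
    · simp only [add_sub_cancel_left] at hx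
      simpa using (hJ.tendsto_zero_of_output hA hdet hS hx).const_add xs
  refine ⟨main, fun h => ?_⟩
  have : (PartialOp.ofLinear A).withInput B us = PartialOp.ofLinear A := by
    simp [PartialOp.withInput, h]
  rwa [this] at main
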